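/- **Model.** An instance $\mathcal I=(\Omega,A,u,v,\mu^*)$ consists of a finite set $\Omega$ of states, a finite set $A$ of actions, utilities $u,v:A\times\Omega\to[0,1]$ of an information designer and of a receiver, and a prior $\mu^*\in\Delta(\Omega)$. A signaling scheme with a finite signal set $S$ is a map $\pi:\Omega\to\Delta(S)$. Given $\pi$ and a realized signal $s$, an action $a$ is optimal for the receiver if it maximizes $\sum_{\omega}\mu^*(\omega)\pi(s\mid\omega)v(a,\omega)$. If the receiver answers each signal $s$ with an optimal action $a_s$, the designer's expected utility is $\sum_\omega\mu^*(\omega)\sum_s\pi(s\mid\omega)u(a_s,\omega)$; $U^*$ denotes the supremum of this quantity over all signaling schemes with finitely many signals and all choices of optimal actions. In the binary-action case, $A=\{0,1\}$, $u(1,\omega)>u(0,\omega)$ for all $\omega$, and $\sum_\omega\mu^*(\omega)(v(0,\omega)-v(1,\omega))>0$. The game is repeated for $T$ periods. In period $t$ the designer announces a scheme $\pi^{(t)}$; a state $\omega^{(t)}\sim\mu^*$ is drawn independently of the past, then a signal $s^{(t)}\sim\pi^{(t)}(\cdot\mid\omega^{(t)})$, and the receiver, who knows $\mu^*$, $\pi^{(t)}$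 and $s^{(t)}$, takes an optimal action $a^{(t)}$, ties being broken arbitrarily. A (possibly randomized) learning algorithm knows $T$, $u$, $v$ but not $\mu^*$, and chooses $\pi^{(t)}$ as a function of its internal randomness and of the past schemes, states, signals and actions (it need not use the states). Its regret is $$\mathrm{Reg}(T;\mathcal I)=T\,U^*-\mathbb E\Big[\sum_{t=1}^T u(a^{(t)},\omega^{(t)})\Big].$$ **Theorem.** There is an absolute constant $c>0$ such that for every learning algorithm that only uses signaling schemes with two signals, and for every $T\ge 3$, there is an instance $\mathcal I$ of the binary-action case with exactly two states and a full-support prior such that, however the receivers break ties (measurably, possibly depending on the past states, signals and actions), $\mathrm{Reg}(T;\mathcal I)\ge c\,\log\log T$. -/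

import Mathlib

open MeasureTheory

universe u

/-- A single-period Bayesian persuasion instance `{Ω, A, u, v, μ*}`: utilities of the designer (`u`)
and of the receiver (`v`) with values in `[0, 1]`, and a prior `μ* ∈ Δ(Ω)`. -/
structure PersuasionInstance (Ω A : Type) [Fintype Ω] where
  /-- the designer's utility -/
  u : A → Ω → ℝ
  /-- the receiver's utility -/
  v : A → Ω → ℝ
  /-- the prior, which is also the true distribution of the state -/
  prior : Ω → ℝ
  u_mem : ∀ a ω, u a ω ∈ Set.Icc (0 : ℝ) 1
  v_mem : ∀ a ω, v a ω ∈ Set.Icc (0 : ℝ) 1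
  prior_mem : prior ∈ stdSimplex ℝ Ω

/-- A signaling scheme `π : Ω → Δ(S)`; `(π ω).1 s` is the probability `π(s | ω)`. -/
abbrev SignalingScheme (Ω S : Type) [Fintype S] : Type := Ω → ↥(stdSimplex ℝ S)

namespace PersuasionInstance

variable {Ω A S : Type} [Fintype Ω] [Fintype S]

/-- Action `a` is optimal for the receiver on receiving the signal `s` from the scheme `π`, that is,
it maximizes `∑ ω, μ*(ω) π(s | ω) v(a, ω)`. -/
def IsBestResponse (I : PersuasionInstance Ω A) (π : SignalingScheme Ω S) (s : S) (a : A) : Prop :=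
  ∀ a' : A, ∑ ω, I.prior ω * (π ω).1 s * I.v a' ω ≤ ∑ ω, I.prior ω * (π ω).1 s * I.v a ω

/-- The designer's expected utility when she uses `π` and the receiver answers signal `s`
with the action `a s`. -/
def utility (I : PersuasionInstance Ω A) (π : SignalingScheme Ω S) (a : S → A) : ℝ :=
  ∑ ω, I.prior ω * ∑ s, (π ω).1 s * I.u (a s) ω

/-- The optimal utility `U*` for a known prior: the supremum of the designer's expected utility over
all signaling schemes with any finite set of signals and all optimal behaviors of the receiver. -/
noncomputable def optimalUtility (I : PersuasionInstance Ω A) : ℝ :=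
  sSup {x : ℝ | ∃ (k : ℕ) (π : SignalingScheme Ω (Fin k)) (a : Fin k → A),
    (∀ s, I.IsBestResponse π s (a s)) ∧ x = I.utility π a}

/-- The standing assumptions of the binary-action case: the designer strictly prefers action `1`
in every state, and the receiver strictly prefers action `0` at the prior. -/
def IsBinaryActionCase (I : PersuasionInstance Ω (Fin 2)) : Prop :=
  (∀ ω, I.u 0 ω < I.u 1 ω) ∧ 0 < ∑ ω, I.prior ω * (I.v 0 ω - I.v 1 ω)

end PersuasionInstance

/-- What happened in the past periods, the most recent one first: for each period the realized
state, the realized signal and the action of the receiver. -/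
abbrev PersuasionHistory (Ω S A : Type) : Type := List (Ω × S × A)

/-- A (possibly randomized) policy of the designer, who announces a scheme with signals in `S`
as a function of the history. All internal randomness is drawn as a seed at the start; given the
seed, the past schemes are determined by the history. -/
structure PersuasionPolicy (Ω S A : Type) [Fintype S] where
  /-- the probability space of the internal randomness -/
  Seed : Type u
  [seedSpace : MeasurableSpace Seed]
  seedLaw : Measure Seed
  [seedProb : IsProbabilityMeasure seedLaw]
  /-- the scheme announced after a given history -/
  scheme : Seed → PersuasionHistory Ω S A → SignalingScheme Ω S
  measurable_scheme : ∀ h, Measurable fun r => scheme r h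

/-- A learning algorithm with signals in `S`: it knows the number of periods `T` and the two utility
functions `u`, `v`, but not the prior. -/
abbrev PersuasionAlgorithm (Ω S A : Type) [Fintype S] : Type (u + 1) :=
  (T : ℕ) → (u v : A → Ω → ℝ) → PersuasionPolicy.{u} Ω S A

/-- The behavior of the receivers: each of them takes an optimal action, and ties are broken in an
arbitrary (measurable) way, which may depend on the history. -/
structure ReceiverBehavior {Ω A : Type} [Fintype Ω] (I : PersuasionInstance Ω A)
    (S : Type) [Fintype S] where
  act : PersuasionHistory Ω S A → SignalingScheme Ω S → S → A
  measurable_act : ∀ h s a, MeasurableSet {π : SignalingScheme Ω S | act h π s = a}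
  optimal : ∀ h π s, I.IsBestResponse π s (act h π s)

namespace PersuasionInstance

variable {Ω A S : Type} [Fintype Ω] [Fintype S]

/-- The expected total utility of the designer over the next `k` periods after the history `h`,
when she uses the (deterministic) policy `σ` : in each period a fresh state is drawn from the prior,
then a signal is drawn from the announced scheme at that state, then the receiver acts. -/
noncomputable def totalUtility (I : PersuasionInstance Ω A) (b : ReceiverBehavior I S)
    (σ : PersuasionHistory Ω S A → SignalingScheme Ω S) : ℕ → PersuasionHistory Ω S A → ℝ
  | 0, _ => 0
  | k + 1, h => ∑ ω, I.prior ω * ∑ s, (σ h ω).1 s *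
      (I.u (b.act h (σ h) s) ω + totalUtility I b σ k ((ω, s, b.act h (σ h) s) :: h))

/-- The regret `Reg(T; I) = T * U* - E[∑ t, u(a_t, ω_t)]` of a policy over `T` periods. -/
noncomputable def regret (I : PersuasionInstance Ω A) (b : ReceiverBehavior I S)
    (P : PersuasionPolicy.{u} Ω S A) (T : ℕ) : ℝ :=
  letI := P.seedSpace
  T * I.optimalUtility - ∫ r, I.totalUtility b (P.scheme r) T [] ∂P.seedLaw

end PersuasionInstance

/-! With the utilities fixed, the unknown is the prior odds `θ`, and a two-signal scheme acts like a
posted price `x`, the likelihood ratio of its favorable signal. If `x > θ`, nobody is persuaded, at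
a constant loss; if `x ≤ θ`, the loss is at least `(θ - x) / 2` (`gain_le`). Such pricing problems
force a regret of order log log T, provided that the observed states say little about `θ`.

The targets are the leaves of a tree in which an interval of length `w = 1 / (2N)` at level `k` has
`N = 4 ^ 2 ^ k` parts. Over `N / 4` periods, the probability of any history changes at most by a
constant factor within the interval (`mul_oddsPrior_le`), so only the actions can locate the part.
Either the probes stay low and lose an amount of order `w` in each of these periods, or a probe
moves up and overshoots every target in the parts below it. A potential argument
(`sum_stoppedCharge_ge`) yields a constant charge per level, averaged over the parts.

The charges of all levels at one probe telescope to at most the order of the true loss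
(`sum_charge_le`), so the constants of the levels add up. A uniformly random leaf of depth `K` thus
costs order `K`, and `N ≤ 4T` leaves room for order log log T levels. -/

namespace ThresholdPersuasion

/-! ### Instances parametrized by the prior odds -/

/-- The designer wants action `1` in every state. -/
def designerUtility (a _ω : Fin 2) : ℝ := if a = 1 then 1 else 0

/-- The receiver wants to match the state. -/
def receiverUtility (a ω : Fin 2) : ℝ := if a = ω then 1 else 0

/-- The prior on two states with odds `θ` in favor of state `1`. -/
noncomputable def oddsPrior (θ : ℝ) : Fin 2 → ℝ := ![1 / (1 + θ), θ / (1 + θ)]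

lemma oddsPrior_pos {θ : ℝ} (hθ : 0 < θ) (ω : Fin 2) : 0 < oddsPrior θ ω := by
  fin_cases ω <;> simp [oddsPrior] <;> positivity

lemma oddsPrior_nonneg {θ : ℝ} (hθ : 0 ≤ θ) (ω : Fin 2) : 0 ≤ oddsPrior θ ω := by
  fin_cases ω <;> simp [oddsPrior] <;> positivity

lemma sum_oddsPrior {θ : ℝ} (hθ : 0 ≤ θ) : ∑ ω, oddsPrior θ ω = 1 := by
  have : 1 + θ ≠ 0 := by positivity
  simp [oddsPrior, Fin.sum_univ_two]
  field_simp

/-- The persuasion instance in which the receiver matches the state and the prior odds of state `1`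
are `θ`; the designer can persuade exactly up to the likelihood ratio `θ`. -/
noncomputable def matchingInstance (θ : ℝ) (hθ : 0 ≤ θ) : PersuasionInstance (Fin 2) (Fin 2) where
  u := designerUtility
  v := receiverUtility
  prior := oddsPrior θ
  u_mem a ω := by unfold designerUtility; split_ifs <;> simp
  v_mem a ω := by unfold receiverUtility; split_ifs <;> simp
  prior_mem := ⟨oddsPrior_nonneg hθ, sum_oddsPrior hθ⟩

lemma matchingInstance_isBinaryActionCase {θ : ℝ} (hθ : 0 ≤ θ) (h1 : θ < 1) :
    (matchingInstance θ hθ).IsBinaryActionCase := by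
  refine ⟨fun ω => by simp [matchingInstance, designerUtility], ?_⟩
  have h : 0 < (1 - θ) / (1 + θ) := div_pos (by linarith) (by linarith)
  have e : ∑ ω, (matchingInstance θ hθ).prior ω *
      ((matchingInstance θ hθ).v 0 ω - (matchingInstance θ hθ).v 1 ω) = (1 - θ) / (1 + θ) := by
    simp [matchingInstance, receiverUtility, oddsPrior, Fin.sum_univ_two]
    ring
  rw [e]
  exact h

/-! ### The threshold of a two-signal scheme -/

section Scheme

variable (π : SignalingScheme (Fin 2) (Fin 2))

lemma scheme_nonneg (ω s : Fin 2) : 0 ≤ (π ω).1 s := (π ω).2.1 s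

lemma scheme_sum (ω : Fin 2) : (π ω).1 0 + (π ω).1 1 = 1 := by
  have := (π ω).2.2
  rwa [Fin.sum_univ_two] at this

lemma scheme_le_one (ω s : Fin 2) : (π ω).1 s ≤ 1 := by
  have h0 := scheme_nonneg π ω 0
  have h1 := scheme_nonneg π ω 1
  have h := scheme_sum π ω
  fin_cases s <;> simp <;> linarith

/-- The signal that speaks for state `1`. -/
noncomputable def favorableSignal : Fin 2 := if (π 0).1 1 ≤ (π 1).1 1 then 1 else 0

/-- The likelihood ratio of the favorable signal; it is `1` if that signal is never sent. -/
noncomputable def threshold : ℝ :=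
  if (π 1).1 (favorableSignal π) = 0 then 1
  else (π 0).1 (favorableSignal π) / (π 1).1 (favorableSignal π)

lemma favorableSignal_le :
    (π 0).1 (favorableSignal π) ≤ (π 1).1 (favorableSignal π) := by
  have h0 := scheme_sum π 0
  have h1 := scheme_sum π 1
  unfold favorableSignal
  split_ifs with h
  · exact h
  · linarith

lemma scheme_other {s : Fin 2} (hs : s ≠ favorableSignal π) (ω : Fin 2) :
    (π ω).1 s = 1 - (π ω).1 (favorableSignal π) := by
  have h := scheme_sum π ω
  generalize favorableSignal π = g at *
  fin_cases s <;> fin_cases g <;> simp at hs ⊢ <;> linarith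

/-- If the favorable signal is never sent in state `1`, it is never sent in state `0` either, and
both sides vanish. The default threshold `1` lies above every `θ < 1`, so such a scheme counts as
overshooting. -/
lemma favorable_eq :
    (π 0).1 (favorableSignal π) = threshold π * (π 1).1 (favorableSignal π) := by
  have h := favorableSignal_le π
  have h0 := scheme_nonneg π 0 (favorableSignal π)
  unfold threshold
  split_ifs with hr
  · linarith
  · field_simp

lemma favorable_pos_of_threshold_lt_one (h : threshold π < 1) :
    0 < (π 1).1 (favorableSignal π) := by
  refine lt_of_le_of_ne (scheme_nonneg π 1 _) fun e => ?_
  unfold threshold at h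
  rw [if_pos e.symm] at h
  exact lt_irrefl _ h

lemma other_lt {θ : ℝ} (h1 : θ < 1) {s : Fin 2} (hs : s ≠ favorableSignal π)
    (h : threshold π ≤ θ) : θ * (π 1).1 s < (π 0).1 s := by
  rw [scheme_other π hs, scheme_other π hs, favorable_eq]
  have hr := scheme_nonneg π 1 (favorableSignal π)
  nlinarith

/-- The favorable signal has ratio `threshold π > θ`, and the other one has ratio at least `1`. A
signal that is never sent must be excluded, since every action is optimal after it. -/
lemma lt_of_lt_threshold {θ : ℝ} (hθ : 0 ≤ θ) (h1 : θ < 1) (h : θ < threshold π) {ω s : Fin 2}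
    (hs : (π ω).1 s ≠ 0) : θ * (π 1).1 s < (π 0).1 s := by
  by_cases hg : s = favorableSignal π
  · subst hg
    have hr := scheme_nonneg π 1 (favorableSignal π)
    rw [favorable_eq]
    have hr' : 0 < (π 1).1 (favorableSignal π) := by
      refine lt_of_le_of_ne hr fun e => hs ?_
      fin_cases ω
      · have := favorable_eq π
        rw [← e, mul_zero] at this
        exact this
      · exact e.symm
    nlinarith
  · have hle := favorableSignal_le π
    have h0 := scheme_nonneg π 0 s
    have h1' := scheme_nonneg π 1 s
    have hle' : (π 1).1 s ≤ (π 0).1 s := by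
      rw [scheme_other π hg, scheme_other π hg]; linarith
    have hpos : 0 < (π 0).1 s := by
      refine lt_of_le_of_ne h0 fun e => hs ?_
      fin_cases ω
      · exact e.symm
      · exact le_antisymm (by simpa [← e] using hle') h1'
    nlinarith [mul_nonneg hθ h1']

end Scheme

/-! ### The receiver's response in terms of the threshold -/

section BestResponse

variable {θ : ℝ} {hθ : 0 ≤ θ} {π : SignalingScheme (Fin 2) (Fin 2)} {s a : Fin 2}

lemma isBestResponse_matching_iff {S : Type} [Fintype S] {π : SignalingScheme (Fin 2) S} {s : S} :
    (matchingInstance θ hθ).IsBestResponse π s a ↔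
      (a = 1 → (π 0).1 s ≤ θ * (π 1).1 s) ∧ (a = 0 → θ * (π 1).1 s ≤ (π 0).1 s) := by
  have h : 0 < 1 + θ := by linarith
  have e : ∀ x y : ℝ, (1 + θ)⁻¹ * x ≤ θ / (1 + θ) * y ↔ x ≤ θ * y := by
    intro x y
    rw [inv_mul_le_iff₀ h]
    have : (1 + θ) * (θ / (1 + θ) * y) = θ * y := by field_simp
    rw [this]
  have e' : ∀ x y : ℝ, θ / (1 + θ) * y ≤ (1 + θ)⁻¹ * x ↔ θ * y ≤ x := by
    intro x y
    rw [le_inv_mul_iff₀ h]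
    have : (1 + θ) * (θ / (1 + θ) * y) = θ * y := by field_simp
    rw [this]
  unfold PersuasionInstance.IsBestResponse
  fin_cases a <;>
    simp [matchingInstance, receiverUtility, oddsPrior, Fin.forall_fin_two, e, e']

lemma action_eq_zero (h1 : θ < 1) (ha : (matchingInstance θ hθ).IsBestResponse π s a)
    (h : θ < threshold π) {ω : Fin 2} (hs : (π ω).1 s ≠ 0) : a = 0 := by
  have hlt := lt_of_lt_threshold π hθ h1 h hs
  by_contra hne
  have : a = 1 := by omega
  exact absurd ((isBestResponse_matching_iff.1 ha).1 this) (not_le.2 hlt)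

lemma action_eq_zero_of_ne (h1 : θ < 1) (ha : (matchingInstance θ hθ).IsBestResponse π s a)
    (h : threshold π ≤ θ) (hs : s ≠ favorableSignal π) : a = 0 := by
  have hlt := other_lt π h1 hs h
  by_contra hne
  have : a = 1 := by omega
  exact absurd ((isBestResponse_matching_iff.1 ha).1 this) (not_le.2 hlt)

/-- Strictness matters: at `threshold π = θ` the favorable signal leaves the receiver indifferent.
-/
lemma action_eq_ite (h1 : θ < 1) (ha : (matchingInstance θ hθ).IsBestResponse π s a)
    (h : threshold π < θ) : a = if s = favorableSignal π then 1 else 0 := by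
  split_ifs with hs
  · subst hs
    by_contra hne
    have h0 : a = 0 := by omega
    have := (isBestResponse_matching_iff.1 ha).2 h0
    have hpos := favorable_pos_of_threshold_lt_one π (h.trans h1)
    rw [favorable_eq] at this
    nlinarith
  · exact action_eq_zero_of_ne h1 ha h.le hs

end BestResponse

/-! ### The benchmark and the loss in one period -/

/-- The scheme that persuades as often as possible when the odds are `θ`. -/
noncomputable def optimalScheme (θ : ℝ) (hθ : 0 ≤ θ) (h1 : θ ≤ 1) :
    SignalingScheme (Fin 2) (Fin 2) :=
  ![⟨![1 - θ, θ], by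
      constructor
      · intro s; fin_cases s <;> simp <;> linarith
      · simp [Fin.sum_univ_two]⟩,
    ⟨![0, 1], by
      constructor
      · intro s; fin_cases s <;> simp
      · simp [Fin.sum_univ_two]⟩]

lemma utility_le_one {Ω A S : Type} [Fintype Ω] [Fintype S] (I : PersuasionInstance Ω A)
    (π : SignalingScheme Ω S) (a : S → A) : I.utility π a ≤ 1 := by
  calc I.utility π a ≤ ∑ ω, I.prior ω * ∑ s, (π ω).1 s * 1 := by
        unfold PersuasionInstance.utility
        gcongr with ω _ s _
        · exact I.prior_mem.1 ω
        · exact (π ω).2.1 s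
        · exact (I.u_mem _ _).2
    _ = 1 := by
        have : ∀ ω, ∑ s, (π ω).1 s = 1 := fun ω => (π ω).2.2
        simp only [mul_one, this]
        exact I.prior_mem.2

lemma le_optimalUtility {θ : ℝ} (hθ : 0 ≤ θ) (h1 : θ ≤ 1) :
    2 * (θ / (1 + θ)) ≤ (matchingInstance θ hθ).optimalUtility := by
  refine le_csSup ⟨1, ?_⟩ ⟨2, optimalScheme θ hθ h1, id, ?_, ?_⟩
  · rintro x ⟨k, π, a, -, rfl⟩
    exact utility_le_one _ _ _
  · intro s
    rw [isBestResponse_matching_iff]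
    fin_cases s <;> simp [optimalScheme]
    linarith
  · simp [PersuasionInstance.utility, optimalScheme, matchingInstance, designerUtility, oddsPrior,
      Fin.sum_univ_two]
    ring

/-- The mean of `f ω s` when the state is drawn from `p` and the signal from the scheme `π`. -/
def stepMean (p : Fin 2 → ℝ) (π : SignalingScheme (Fin 2) (Fin 2)) (f : Fin 2 → Fin 2 → ℝ) : ℝ :=
  ∑ ω, p ω * ∑ s, (π ω).1 s * f ω s

section StepMean

variable {p p' : Fin 2 → ℝ} {π : SignalingScheme (Fin 2) (Fin 2)} {f g : Fin 2 → Fin 2 → ℝ}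

/-- Signals that are never sent have no weight, so the comparison is needed only where the response
is determined. Two different priors are allowed for the sake of a change of measure. -/
lemma stepMean_le_stepMean
    (h : ∀ ω s, (π ω).1 s ≠ 0 → p ω * f ω s ≤ p' ω * g ω s) :
    stepMean p π f ≤ stepMean p' π g := by
  unfold stepMean
  simp only [Finset.mul_sum]
  refine Finset.sum_le_sum fun ω _ => Finset.sum_le_sum fun s _ => ?_
  by_cases hs : (π ω).1 s = 0
  · simp [hs]
  · have := mul_le_mul_of_nonneg_left (h ω s hs) (scheme_nonneg π ω s)
    linarith

lemma stepMean_const (hp : ∑ ω, p ω = 1) (c : ℝ) : stepMean p π (fun _ _ => c) = c := by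
  have : ∀ ω, ∑ s, (π ω).1 s = 1 := fun ω => (π ω).2.2
  simp only [stepMean, ← Finset.sum_mul, this, one_mul, hp]

lemma stepMean_add :
    stepMean p π (fun ω s => f ω s + g ω s) = stepMean p π f + stepMean p π g := by
  simp only [stepMean, mul_add, Finset.sum_add_distrib]

lemma stepMean_sum {ι : Type*} (t : Finset ι) (F : ι → Fin 2 → Fin 2 → ℝ) :
    stepMean p π (fun ω s => ∑ i ∈ t, F i ω s) = ∑ i ∈ t, stepMean p π (F i) := by
  classical
  induction t using Finset.induction_on with
  | empty => simp [stepMean]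
  | insert i t hi ih => simp only [Finset.sum_insert hi, stepMean_add, ih]

lemma stepMean_const_mul (c : ℝ) :
    stepMean p π (fun ω s => c * f ω s) = c * stepMean p π f := by
  simp only [stepMean, Finset.mul_sum]
  refine Finset.sum_congr rfl fun ω _ => Finset.sum_congr rfl fun s _ => by ring

lemma stepMean_mono (hp : ∀ ω, 0 ≤ p ω) (h : ∀ ω s, f ω s ≤ g ω s) :
    stepMean p π f ≤ stepMean p π g :=
  stepMean_le_stepMean fun ω s _ => mul_le_mul_of_nonneg_left (h ω s) (hp ω)

lemma stepMean_nonneg (hp : ∀ ω, 0 ≤ p ω) (h : ∀ ω s, 0 ≤ f ω s) : 0 ≤ stepMean p π f := by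
  unfold stepMean
  exact Finset.sum_nonneg fun ω _ => mul_nonneg (hp ω)
    (Finset.sum_nonneg fun s _ => mul_nonneg (scheme_nonneg π ω s) (h ω s))

end StepMean

/-- The designer's expected gain in one period is at most `2 θ / (1 + θ)` minus a loss that is
bounded below in terms of the threshold of the scheme. -/
lemma gain_le {θ : ℝ} (hθ : 0 ≤ θ) (h1 : θ < 1) (π : SignalingScheme (Fin 2) (Fin 2))
    (a : Fin 2 → Fin 2) (ha : ∀ s, (matchingInstance θ hθ).IsBestResponse π s (a s)) :
    stepMean (oddsPrior θ) π (fun ω s => designerUtility (a s) ω) ≤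
      2 * (θ / (1 + θ)) - if θ < threshold π then 2 * (θ / (1 + θ)) else (θ - threshold π) / 2 := by
  split_ifs with h
  · rw [sub_self, ← stepMean_const (π := π) (sum_oddsPrior hθ) 0]
    refine stepMean_le_stepMean fun ω s hs => ?_
    rw [action_eq_zero h1 (ha s) h hs]
    simp [designerUtility]
  · push Not at h
    set g := favorableSignal π with hg
    have hx := favorable_eq π
    have hle : stepMean (oddsPrior θ) π (fun ω s => designerUtility (a s) ω) ≤
        stepMean (oddsPrior θ) π (fun ω s => if s = g then 1 else 0) := by
      refine stepMean_mono (oddsPrior_nonneg hθ) fun ω s => ?_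
      split_ifs with hs
      · unfold designerUtility; split_ifs <;> simp
      · rw [action_eq_zero_of_ne h1 (ha s) h hs]
        simp [designerUtility]
    refine hle.trans ?_
    have e : stepMean (oddsPrior θ) π (fun ω s => if s = g then 1 else 0) =
        (1 + θ)⁻¹ * ((π 0).1 g + θ * (π 1).1 g) := by
      simp [stepMean, oddsPrior, Fin.sum_univ_two]
      ring
    rw [e, hx, inv_mul_le_iff₀ (by linarith)]
    have hr1 := scheme_le_one π 1 g
    have hr0 := scheme_nonneg π 1 g
    have hxr : 0 ≤ threshold π := by
      unfold threshold
      split_ifs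
      · norm_num
      · exact div_nonneg (scheme_nonneg π 0 _) (scheme_nonneg π 1 _)
    have e2 : (1 + θ) * (2 * (θ / (1 + θ)) - (θ - threshold π) / 2) =
        2 * θ - (1 + θ) * (θ - threshold π) / 2 := by
      field_simp
    rw [e2]
    -- The first product replaces `1 / (1 + θ)` by `1 / 2`; the second replaces the probability of
    -- the favorable signal in state `1` by `1`.
    nlinarith [mul_nonneg (sub_nonneg.2 h1.le) (sub_nonneg.2 h),
      mul_nonneg (sub_nonneg.2 hr1) (add_nonneg hxr hθ)]

/-! ### Charges along nested intervals -/

/-- The charge at the level of an interval `[a, a + w)` with subinterval `[a', a' + w')` for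
a probe at `x`; `F` is the charge for overshooting the subinterval within the interval. -/
noncomputable def charge (F a w a' w' x : ℝ) : ℝ :=
  if a + w ≤ x then a' - a else if a' + w' ≤ x then F else max x a' - max x a

lemma charge_nonneg {F a w a' w' : ℝ} (hF : 0 ≤ F) (ha : a ≤ a') (x : ℝ) :
    0 ≤ charge F a w a' w' x := by
  unfold charge
  split_ifs
  · linarith
  · exact hF
  · exact sub_nonneg.2 (max_le_max le_rfl ha)

/-- The charges along nested intervals are together at most the distance by which a probe
stays below the target, and bounded if the probe is above the target. -/
lemma sum_charge_le {F : ℝ} (hF : 0 ≤ F) {a w : ℕ → ℝ} (ha : Monotone a)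
    (haw : Antitone fun k => a k + w k) (hw : ∀ k, 0 < w k) (K : ℕ) (x : ℝ) :
    ∑ k ∈ Finset.range K, charge F (a k) (w k) (a (k + 1)) (w (k + 1)) x ≤
      if a K < x then a K - a 0 + F else a K - x := by
  split_ifs with h
  -- The right ends decrease, so `F` is charged only at the level where `x` leaves the nested
  -- intervals; the difference of indicators telescopes to at most `F`.
  · have step : ∀ k ∈ Finset.range K, charge F (a k) (w k) (a (k + 1)) (w (k + 1)) x ≤
        (a (k + 1) - a k) + ((if x < a (k + 1) + w (k + 1) then -F else 0) -
          (if x < a k + w k then -F else 0)) := by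
      intro k hk
      have hk' : a (k + 1) < x := (ha (Finset.mem_range.1 hk)).trans_lt h
      have hmono : a k ≤ a (k + 1) := ha k.le_succ
      have hanti : a (k + 1) + w (k + 1) ≤ a k + w k := haw k.le_succ
      have hmax : max x (a (k + 1)) - max x (a k) = 0 := by
        rw [max_eq_left hk'.le, max_eq_left (hmono.trans hk'.le), sub_self]
      unfold charge
      rw [hmax]
      split_ifs <;> linarith
    refine (Finset.sum_le_sum step).trans ?_
    rw [Finset.sum_add_distrib, Finset.sum_range_sub,
      Finset.sum_range_sub (fun k => if x < a k + w k then -F else 0)]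
    split_ifs <;> linarith
  -- Below the target no level is overshot, and each charge is the part of the gap above `x` between
  -- consecutive left ends.
  · have step : ∀ k ∈ Finset.range K, charge F (a k) (w k) (a (k + 1)) (w (k + 1)) x ≤
        max x (a (k + 1)) - max x (a k) := by
      intro k hk
      have lt : ∀ i ≤ K, x < a i + w i := fun i hi => by
        have := haw hi
        dsimp only at this
        linarith [hw K]
      have hk := Finset.mem_range.1 hk
      unfold charge
      rw [if_neg (not_le.2 (lt k hk.le)), if_neg (not_le.2 (lt (k + 1) hk))]
    refine (Finset.sum_le_sum step).trans ?_
    rw [Finset.sum_range_sub (fun k => max x (a k)), max_eq_right (not_lt.1 h)]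
    linarith [le_max_left x (a 0)]

/-! ### The reference process and the change of measure -/

/-- The action with which a receiver responds when the target is known to be in the interval
starting at `a` of length `w`, and the threshold is not close to the target. -/
noncomputable def referenceAction (a w : ℝ) (π : SignalingScheme (Fin 2) (Fin 2)) (s : Fin 2) :
    Fin 2 :=
  if a + w ≤ threshold π then 0 else if s = favorableSignal π then 1 else 0

/-- The expected total cost over the next `n` periods, for a cost `c` of each history. -/
def cumulative (p : Fin 2 → ℝ)
    (act : PersuasionHistory (Fin 2) (Fin 2) (Fin 2) → Fin 2 → Fin 2)
    (σ : PersuasionHistory (Fin 2) (Fin 2) (Fin 2) → SignalingScheme (Fin 2) (Fin 2))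
    (c : PersuasionHistory (Fin 2) (Fin 2) (Fin 2) → ℝ) :
    ℕ → PersuasionHistory (Fin 2) (Fin 2) (Fin 2) → ℝ
  | 0, _ => 0
  | n + 1, h => c h + stepMean p (σ h) fun ω s => cumulative p act σ c n ((ω, s, act h s) :: h)

/-- The expected charge for the `j`-th of the subintervals of length `δ` of an interval starting at
`a` of length `w`, in the reference process that is stopped when a threshold in `[a, a + w)` reaches
the subinterval. -/
noncomputable def stoppedCharge (F a w δ : ℝ)
    (σ : PersuasionHistory (Fin 2) (Fin 2) (Fin 2) → SignalingScheme (Fin 2) (Fin 2)) (j : ℕ) :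
    ℕ → PersuasionHistory (Fin 2) (Fin 2) (Fin 2) → ℝ
  | 0, _ => 0
  | n + 1, h => charge F a w (a + j * δ) δ (threshold (σ h)) +
      if a + w ≤ threshold (σ h) ∨ threshold (σ h) < a + j * δ then
        stepMean (oddsPrior a) (σ h) fun ω s =>
          stoppedCharge F a w δ σ j n ((ω, s, referenceAction a w (σ h) s) :: h)
      else 0

section Cumulative

variable {p : Fin 2 → ℝ} {act : PersuasionHistory (Fin 2) (Fin 2) (Fin 2) → Fin 2 → Fin 2}
  {σ : PersuasionHistory (Fin 2) (Fin 2) (Fin 2) → SignalingScheme (Fin 2) (Fin 2)}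
  {c : PersuasionHistory (Fin 2) (Fin 2) (Fin 2) → ℝ}

lemma cumulative_nonneg (hp : ∀ ω, 0 ≤ p ω) (hc : ∀ h, 0 ≤ c h) (n : ℕ)
    (h : PersuasionHistory (Fin 2) (Fin 2) (Fin 2)) : 0 ≤ cumulative p act σ c n h := by
  induction n generalizing h with
  | zero => exact le_rfl
  | succ n ih => exact add_nonneg (hc h) (stepMean_nonneg hp fun ω s => ih _)

/-- Further periods only add cost, so each level may be studied over an initial stretch of its own
length. -/
lemma cumulative_mono (hp : ∀ ω, 0 ≤ p ω) (hc : ∀ h, 0 ≤ c h) {m n : ℕ} (hmn : m ≤ n)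
    (h : PersuasionHistory (Fin 2) (Fin 2) (Fin 2)) :
    cumulative p act σ c m h ≤ cumulative p act σ c n h := by
  induction m generalizing n h with
  | zero => exact cumulative_nonneg hp hc n h
  | succ m ih =>
    obtain ⟨n, rfl⟩ : ∃ n', n = n' + 1 := ⟨n - 1, by omega⟩
    exact add_le_add le_rfl (stepMean_mono hp fun ω s => ih (by omega) _)

lemma cumulative_sum {ι : Type*} (t : Finset ι)
    (C : ι → PersuasionHistory (Fin 2) (Fin 2) (Fin 2) → ℝ) (n : ℕ)
    (h : PersuasionHistory (Fin 2) (Fin 2) (Fin 2)) :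
    cumulative p act σ (fun h => ∑ i ∈ t, C i h) n h = ∑ i ∈ t, cumulative p act σ (C i) n h := by
  induction n generalizing h with
  | zero => simp [cumulative]
  | succ n ih => simp only [cumulative, ih, stepMean_sum, Finset.sum_add_distrib]

lemma cumulative_const_mul (r : ℝ) (n : ℕ) (h : PersuasionHistory (Fin 2) (Fin 2) (Fin 2)) :
    cumulative p act σ (fun h => r * c h) n h = r * cumulative p act σ c n h := by
  induction n generalizing h with
  | zero => simp [cumulative]
  | succ n ih => simp only [cumulative, ih, stepMean_const_mul, mul_add]

end Cumulative

/-- A lower bound on the loss in every period bounds the total utility. -/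
lemma totalUtility_add_cumulative_le {θ : ℝ} (hθ : 0 ≤ θ) (h1 : θ < 1)
    (b : ReceiverBehavior (matchingInstance θ hθ) (Fin 2))
    (σ : PersuasionHistory (Fin 2) (Fin 2) (Fin 2) → SignalingScheme (Fin 2) (Fin 2))
    {c : PersuasionHistory (Fin 2) (Fin 2) (Fin 2) → ℝ}
    (hc : ∀ h, c h ≤ if θ < threshold (σ h) then 2 * (θ / (1 + θ))
      else (θ - threshold (σ h)) / 2)
    (n : ℕ) (h : PersuasionHistory (Fin 2) (Fin 2) (Fin 2)) :
    (matchingInstance θ hθ).totalUtility b σ n h +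
      cumulative (oddsPrior θ) (fun h s => b.act h (σ h) s) σ c n h ≤ n * (2 * (θ / (1 + θ))) := by
  induction n generalizing h with
  | zero => simp [PersuasionInstance.totalUtility, cumulative]
  | succ n ih =>
    have e : (matchingInstance θ hθ).totalUtility b σ (n + 1) h =
        stepMean (oddsPrior θ) (σ h) (fun ω s => designerUtility (b.act h (σ h) s) ω) +
        stepMean (oddsPrior θ) (σ h) (fun ω s => (matchingInstance θ hθ).totalUtility b σ n
          ((ω, s, b.act h (σ h) s) :: h)) := by
      rw [← stepMean_add]
      rfl
    have hg := gain_le hθ h1 (σ h) (b.act h (σ h)) (b.optimal h (σ h))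
    have hrest : stepMean (oddsPrior θ) (σ h) (fun ω s => (matchingInstance θ hθ).totalUtility b σ n
          ((ω, s, b.act h (σ h) s) :: h) + cumulative (oddsPrior θ) (fun h s => b.act h (σ h) s) σ c
          n ((ω, s, b.act h (σ h) s) :: h)) ≤ n * (2 * (θ / (1 + θ))) := by
      refine (stepMean_mono (oddsPrior_nonneg hθ) fun ω s => ih _).trans ?_
      rw [stepMean_const (sum_oddsPrior hθ)]
    rw [stepMean_add] at hrest
    rw [e, cumulative]
    push_cast
    linarith [hc h]

/-- State `1` only gains probability as the odds grow, and state `0` loses at most the factor `1 -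
w`. This is the information in one observed state. -/
lemma mul_oddsPrior_le {a w θ : ℝ} (ha : 0 ≤ a) (hw : 0 ≤ w) (h1 : a ≤ θ) (h2 : θ ≤ a + w)
    (ω : Fin 2) : (1 - w) * oddsPrior a ω ≤ oddsPrior θ ω := by
  have hθ : 0 ≤ θ := ha.trans h1
  fin_cases ω
  · simp only [oddsPrior, Fin.zero_eta, Matrix.cons_val_zero]
    rw [mul_one_div, div_le_div_iff₀ (by linarith) (by linarith)]
    nlinarith [mul_nonneg hw hθ]
  · simp only [oddsPrior, Fin.mk_one, Matrix.cons_val_one, Matrix.cons_val_fin_one]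
    have : a / (1 + a) ≤ θ / (1 + θ) := by
      rw [div_le_div_iff₀ (by linarith) (by linarith)]
      nlinarith
    have h0 : 0 ≤ a / (1 + a) := by positivity
    nlinarith

lemma stoppedCharge_nonneg {F a w δ : ℝ} (hF : 0 ≤ F) (ha : 0 ≤ a) (hδ : 0 ≤ δ)
    (σ : PersuasionHistory (Fin 2) (Fin 2) (Fin 2) → SignalingScheme (Fin 2) (Fin 2)) (j n : ℕ)
    (h : PersuasionHistory (Fin 2) (Fin 2) (Fin 2)) : 0 ≤ stoppedCharge F a w δ σ j n h := by
  induction n generalizing h with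
  | zero => exact le_rfl
  | succ n ih =>
    refine add_nonneg (charge_nonneg hF (le_add_of_nonneg_right (by positivity)) _) ?_
    split_ifs
    · exact stepMean_nonneg (oddsPrior_nonneg ha) fun ω s => ih _
    · exact le_rfl

/-- The actual process dominates the stopped reference process, up to a factor for the
likelihood ratio of the states. -/
lemma stoppedCharge_le_cumulative {F a w δ θ : ℝ} (hF : 0 ≤ F) (ha : 0 ≤ a) (hδ : 0 ≤ δ)
    (hw0 : 0 ≤ w) (hw1 : w ≤ 1) (hθ : 0 ≤ θ) (hθ1 : θ < 1) (j : ℕ) (hjθ : a + j * δ ≤ θ)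
    (hθw : θ < a + w)
    (b : ReceiverBehavior (matchingInstance θ hθ) (Fin 2))
    (σ : PersuasionHistory (Fin 2) (Fin 2) (Fin 2) → SignalingScheme (Fin 2) (Fin 2))
    (n : ℕ) (h : PersuasionHistory (Fin 2) (Fin 2) (Fin 2)) :
    (1 - w) ^ n * stoppedCharge F a w δ σ j n h ≤
      cumulative (oddsPrior θ) (fun h s => b.act h (σ h) s) σ
        (fun h => charge F a w (a + j * δ) δ (threshold (σ h))) n h := by
  have haj : a ≤ a + j * δ := le_add_of_nonneg_right (by positivity)
  induction n generalizing h with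
  | zero => simp [stoppedCharge, cumulative]
  | succ n ih =>
    have hc := charge_nonneg (w := w) (w' := δ) hF haj (threshold (σ h))
    have hpow : (1 - w) ^ (n + 1) ≤ 1 := pow_le_one₀ (by linarith) (by linarith)
    rw [stoppedCharge, cumulative, mul_add]
    refine add_le_add (mul_le_of_le_one_left hc hpow) ?_
    -- Before stopping, the probe is at least `a + w > θ` or below `a + j * δ ≤ θ`, so the receiver
    -- acts as in the reference process. After stopping, the reference charge is zero and
    -- nonnegativity suffices.
    split_ifs with hx
    · rw [← stepMean_const_mul]
      refine stepMean_le_stepMean fun ω s hs => ?_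
      have hact : b.act h (σ h) s = referenceAction a w (σ h) s := by
        have hopt := b.optimal h (σ h) s
        unfold referenceAction
        split_ifs with h1 h2
        · exact action_eq_zero hθ1 hopt (hθw.trans_le h1) hs
        · have := action_eq_ite hθ1 hopt ((hx.resolve_left h1).trans_le hjθ)
          rwa [if_pos h2] at this
        · have := action_eq_ite hθ1 hopt ((hx.resolve_left h1).trans_le hjθ)
          rwa [if_neg h2] at this
      have hp := mul_oddsPrior_le ha hw0 (haj.trans hjθ) hθw.le ω
      have hpa := oddsPrior_nonneg ha ω
      have hD := stoppedCharge_nonneg (w := w) hF ha hδ σ j n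
        ((ω, s, referenceAction a w (σ h) s) :: h)
      have hi := ih ((ω, s, referenceAction a w (σ h) s) :: h)
      have hw : 0 ≤ (1 - w) ^ n := pow_nonneg (by linarith) n
      rw [hact]
      calc oddsPrior a ω * ((1 - w) ^ (n + 1) * stoppedCharge F a w δ σ j n
              ((ω, s, referenceAction a w (σ h) s) :: h))
          = ((1 - w) * oddsPrior a ω) * ((1 - w) ^ n * stoppedCharge F a w δ σ j n
              ((ω, s, referenceAction a w (σ h) s) :: h)) := by ring
        _ ≤ oddsPrior θ ω * ((1 - w) ^ n * stoppedCharge F a w δ σ j n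
              ((ω, s, referenceAction a w (σ h) s) :: h)) :=
            mul_le_mul_of_nonneg_right hp (mul_nonneg hw hD)
        _ ≤ _ := mul_le_mul_of_nonneg_left hi (oddsPrior_nonneg hθ ω)
    · rw [mul_zero]
      refine stepMean_nonneg (oddsPrior_nonneg hθ) fun ω s =>
        cumulative_nonneg (oddsPrior_nonneg hθ) (fun h => charge_nonneg hF haj _) n _

/-! ### The potential argument at one level -/

/-- A linear minorant of the convex function `M (M - 1) / 2` of `M = N - i`. Linearity in `i` makes
the potential drop by a fixed amount per lost subinterval. -/
lemma sum_Ico_sub_mul_ge {δ : ℝ} (hδ : 0 ≤ δ) {N i : ℕ} (hN : 2 ≤ N) (hi : i ≤ N) :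
    N * δ / 4 * ((N - i : ℝ) - N / 2) ≤ ∑ j ∈ Finset.Ico i N, ((j : ℝ) - i) * δ := by
  have e : ∑ j ∈ Finset.Ico i N, ((j : ℝ) - i) * δ = (N - i : ℝ) * (N - i - 1) / 2 * δ := by
    clear hN
    induction N, hi using Nat.le_induction with
    | base => simp
    | succ M hM ih =>
      rw [Finset.sum_Ico_succ_top hM, ih]
      push_cast
      ring
  have hN' : (2 : ℝ) ≤ N := by exact_mod_cast hN
  have hq : (N : ℝ) / 4 * ((N - i : ℝ) - N / 2) ≤ (N - i : ℝ) * (N - i - 1) / 2 := by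
    nlinarith [sq_nonneg ((N - i : ℝ) - (N / 4 + 1 / 2))]
  rw [e]
  calc N * δ / 4 * ((N - i : ℝ) - N / 2) = (N : ℝ) / 4 * ((N - i : ℝ) - N / 2) * δ := by ring
    _ ≤ _ := mul_le_mul_of_nonneg_right hq hδ

/-- The total stopped charge of the subintervals that have not been reached yet. -/
lemma sum_stoppedCharge_ge {F a δ : ℝ} (hF : 0 ≤ F) (ha : 0 ≤ a) (hδ : 0 < δ) {N : ℕ} (hN : 2 ≤ N)
    (σ : PersuasionHistory (Fin 2) (Fin 2) (Fin 2) → SignalingScheme (Fin 2) (Fin 2))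
    (n : ℕ) (hn : n * (N * δ / 4) ≤ F) {i : ℕ} (hi : i ≤ N)
    (h : PersuasionHistory (Fin 2) (Fin 2) (Fin 2)) :
    n * (N * δ / 4 * ((N - i : ℝ) - N / 2) - F) ≤
      ∑ j ∈ Finset.Ico i N, stoppedCharge F a (N * δ) δ σ j n h := by
  induction n generalizing i h with
  | zero => simp [stoppedCharge]
  | succ n ih =>
    have hκ : 0 ≤ N * δ / 4 := by positivity
    push_cast at hn
    have hn' : n * (N * δ / 4) ≤ F := by linarith
    set x := threshold (σ h) with hx
    set R : ℕ → ℝ := fun j => stepMean (oddsPrior a) (σ h) fun ω s =>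
          stoppedCharge F a (N * δ) δ σ j n ((ω, s, referenceAction a (N * δ) (σ h) s) :: h) with hR
    have unfoldD : ∀ j, stoppedCharge F a (N * δ) δ σ j (n + 1) h =
        charge F a (N * δ) (a + j * δ) δ x + if a + N * δ ≤ x ∨ x < a + j * δ then R j else 0 :=
      fun j => rfl
    have hRsum : ∀ i' ≤ N, n * (N * δ / 4 * ((N - i' : ℝ) - N / 2) - F) ≤
        ∑ j ∈ Finset.Ico i' N, R j := by
      intro i' hi'
      rw [hR, ← stepMean_sum, ← stepMean_const (π := σ h) (sum_oddsPrior ha)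
        (n * (N * δ / 4 * ((N - i' : ℝ) - N / 2) - F))]
      exact stepMean_mono (oddsPrior_nonneg ha) fun ω s => ih hn' hi' _
    -- `i'` is the first subinterval that the bound still follows after the probe. The `- 1` allows
    -- for the subinterval containing the probe, which stops without a charge; the `- F` per period
    -- in the bound pays for it.
    have key : ∀ i' ≤ N, i ≤ i' → (∀ j, i' ≤ j → j < N → ((j : ℝ) - i') * δ + R j ≤
        stoppedCharge F a (N * δ) δ σ j (n + 1) h) →
        (((i' : ℝ) - i - 1) * F ≤ ∑ j ∈ Finset.Ico i i', stoppedCharge F a (N * δ) δ σ j (n + 1) h) →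
        ((n + 1 : ℕ) : ℝ) * (N * δ / 4 * ((N - i : ℝ) - N / 2) - F) ≤
          ∑ j ∈ Finset.Ico i N, stoppedCharge F a (N * δ) δ σ j (n + 1) h := by
      intro i' hi' hii' h1 h2
      rw [← Finset.sum_Ico_consecutive _ hii' hi']
      have h3 : ∑ j ∈ Finset.Ico i' N, (((j : ℝ) - i') * δ + R j) ≤
          ∑ j ∈ Finset.Ico i' N, stoppedCharge F a (N * δ) δ σ j (n + 1) h :=
        Finset.sum_le_sum fun j hj => h1 j (Finset.mem_Ico.1 hj).1 (Finset.mem_Ico.1 hj).2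
      rw [Finset.sum_add_distrib] at h3
      have h4 := sum_Ico_sub_mul_ge hδ.le hN hi'
      have h5 := hRsum i' hi'
      have h6 : (i : ℝ) ≤ i' := by exact_mod_cast hii'
      -- Each lost subinterval lowers the bound by `(n + 1) * (N * δ / 4)`, which is at most its
      -- charge `F`.
      have h7 := mul_le_mul_of_nonneg_left hn (sub_nonneg.2 h6)
      push_cast
      nlinarith
    by_cases hfar : a + N * δ ≤ x
    · refine key i hi le_rfl (fun j hj _ => ?_) (by simpa using hF)
      rw [unfoldD, if_pos (Or.inl hfar), charge, if_pos hfar]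
      have : 0 ≤ (i : ℝ) * δ := by positivity
      linarith
    · by_cases hlow : x < a + i * δ
      · refine key i hi le_rfl (fun j hj _ => ?_) (by simpa using hF)
        have hj' : (i : ℝ) * δ ≤ j * δ := by gcongr
        have hi0 : 0 ≤ (i : ℝ) * δ := by positivity
        rw [unfoldD, if_pos (Or.inr (by linarith)), charge, if_neg hfar,
          if_neg (not_le.2 (by linarith)), max_eq_right (by linarith)]
        have : max x a ≤ a + i * δ := max_le hlow.le (by linarith)
        linarith
      · push Not at hfar hlow
        have hi0 : 0 ≤ (i : ℝ) * δ := by positivity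
        -- The subinterval containing the probe: those from `i` to `m - 1` are overshot and pay `F`,
        -- and those above `m` go on.
        set m := ⌊(x - a) / δ⌋₊ with hm
        have hxa : 0 ≤ (x - a) / δ := div_nonneg (by linarith) hδ.le
        have hm1 : m * δ ≤ x - a := (le_div_iff₀ hδ).1 (Nat.floor_le hxa)
        have hm2 : x - a < (m + 1) * δ := (div_lt_iff₀ hδ).1 (Nat.lt_floor_add_one _)
        have him : i ≤ m := Nat.le_floor ((le_div_iff₀ hδ).2 (by linarith))
        have hmN : m < N := by
          rw [hm, Nat.floor_lt hxa, div_lt_iff₀ hδ]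
          linarith
        refine key (m + 1) hmN (by omega) (fun j hj _ => ?_) ?_
        · have hj' : ((m : ℝ) + 1) * δ ≤ j * δ := by
            have : (m : ℝ) + 1 ≤ j := by exact_mod_cast hj
            gcongr
          rw [unfoldD, if_pos (Or.inr (by linarith)), charge, if_neg (not_le.2 hfar),
            if_neg (not_le.2 (by linarith)), max_eq_right (by linarith), max_eq_left (by linarith)]
          push_cast
          linarith
        · rw [Finset.sum_Ico_succ_top him]
          have hlast := stoppedCharge_nonneg (w := N * δ) hF ha hδ.le σ m (n + 1) h
          have hfirst : ∑ j ∈ Finset.Ico i m, F ≤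
              ∑ j ∈ Finset.Ico i m, stoppedCharge F a (N * δ) δ σ j (n + 1) h := by
            refine Finset.sum_le_sum fun j hj => ?_
            have hjm := (Finset.mem_Ico.1 hj).2
            have hj' : ((j : ℝ) + 1) * δ ≤ m * δ := by
              have : (j : ℝ) + 1 ≤ m := by exact_mod_cast hjm
              gcongr
            have hj2 : ¬ (a + N * δ ≤ x ∨ x < a + j * δ) := by
              rintro (h' | h') <;> linarith
            rw [unfoldD, if_neg hj2, charge, if_neg (not_le.2 hfar), if_pos (by linarith), add_zero]
          rw [Finset.sum_const, Nat.card_Ico, nsmul_eq_mul, Nat.cast_sub him] at hfirst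
          push_cast
          linarith

/-! ### Doubly exponential scales and the tree of targets -/

/-- The `k`-th number of subintervals. -/
def branching (k : ℕ) : ℕ := 4 ^ 2 ^ k

/-- The length of the intervals at level `k`. -/
noncomputable def width (k : ℕ) : ℝ := 1 / (2 * branching k)

lemma branching_pos (k : ℕ) : 0 < branching k := by unfold branching; positivity

lemma branching_succ (k : ℕ) : branching (k + 1) = branching k * branching k := by
  unfold branching
  rw [← pow_add, pow_succ 2 k, mul_two]

lemma width_pos (k : ℕ) : 0 < width k := by
  have := branching_pos k
  unfold width; positivity

/-- This balance makes charges of order `width k` over `branching k / 4` periods add up to a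
constant, while `1 - width k` to that power stays bounded below. -/
lemma branching_mul_width (k : ℕ) : branching k * width k = 1 / 2 := by
  have : (branching k : ℝ) ≠ 0 := by exact_mod_cast (branching_pos k).ne'
  unfold width; field_simp

lemma branching_mul_width_succ (k : ℕ) : branching k * width (k + 1) = width k := by
  have : (branching k : ℝ) ≠ 0 := by exact_mod_cast (branching_pos k).ne'
  unfold width
  rw [branching_succ]
  push_cast
  field_simp

lemma four_dvd_branching (k : ℕ) : 4 ∣ branching k := dvd_pow_self 4 (by positivity)

/-- At each level, some constant charge is expected on average over the subintervals. -/
lemma sum_cumulative_charge_ge (k : ℕ) {a : ℝ} (ha : 0 ≤ a) (ha1 : a + width k < 1)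
    (θ : Fin (branching k) → ℝ) (hθ : ∀ j, 0 ≤ θ j) (hθl : ∀ j : Fin (branching k), a + (j : ℕ) * width (k + 1) ≤ θ j)
    (hθr : ∀ j, θ j < a + ((j : ℕ) + 1) * width (k + 1))
    (b : ∀ j, ReceiverBehavior (matchingInstance (θ j) (hθ j)) (Fin 2))
    (σ : PersuasionHistory (Fin 2) (Fin 2) (Fin 2) → SignalingScheme (Fin 2) (Fin 2))
    {T : ℕ} (hT : branching k ≤ 4 * T) :
    branching k * (7 / 1024) ≤ ∑ j : Fin (branching k),
      cumulative (oddsPrior (θ j)) (fun h s => (b j).act h (σ h) s) σ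
        (fun h => charge (1 / 32) a (width k) (a + (j : ℕ) * width (k + 1)) (width (k + 1))
          (threshold (σ h))) T [] := by
  set δ := width (k + 1) with hδ
  generalize hN : branching k = N at *
  have hδ0 : 0 < δ := width_pos _
  have hw0 : 0 < width k := width_pos _
  obtain ⟨n, hn⟩ : 4 ∣ N := hN ▸ four_dvd_branching k
  have hNw : (N : ℝ) * width k = 1 / 2 := hN ▸ branching_mul_width k
  have hNδ : (N : ℝ) * δ = width k := hN ▸ branching_mul_width_succ k
  have hNn : (N : ℝ) = 4 * n := by rw [hn]; push_cast; ring
  have hNpos : 0 < N := hN ▸ branching_pos k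
  have hnw : n * width k = 1 / 8 := by rw [hNn] at hNw; linarith
  have hw1 : width k ≤ 1 := by linarith
  have hbern : (7 : ℝ) / 8 ≤ (1 - width k) ^ n := by
    have := one_add_mul_le_pow (a := -width k) (by linarith) n
    rw [← sub_eq_add_neg] at this
    linarith
  -- `F = 1 / 32` equals `n * width k / 4`, the least value allowed. From `i = 0` the bound is `n *
  -- (1 / 16 - 1 / 32) = N / 128`, and the factor `7 / 8` from Bernoulli's inequality gives `7 N /
  -- 1024`.
  have hsum := sum_stoppedCharge_ge (F := 1 / 32) (by norm_num) ha hδ0 (N := N) (by omega) σ n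
    (by rw [hNδ]; linarith) (Nat.zero_le N) []
  rw [hNδ, ← Finset.range_eq_Ico] at hsum
  calc (N : ℝ) * (7 / 1024) = 7 / 8 * (n * (width k / 4 * ((N - (0 : ℕ) : ℝ) - N / 2) - 1 / 32)) := by
        have : n * (width k / 4 * ((N - (0 : ℕ) : ℝ) - N / 2) - 1 / 32) =
            (N * width k) * n / 8 - n / 32 := by push_cast; ring
        rw [this, hNw, hNn]
        ring
    _ ≤ (1 - width k) ^ n * ∑ j ∈ Finset.range N,
          stoppedCharge (1 / 32) a (width k) δ σ j n [] := by
        refine mul_le_mul hbern hsum ?_ (by positivity)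
        have : n * (width k / 4 * ((N - (0 : ℕ) : ℝ) - N / 2) - 1 / 32) =
            (N * width k) * n / 8 - n / 32 := by push_cast; ring
        rw [this, hNw]
        have : (0 : ℝ) ≤ n := n.cast_nonneg
        linarith
    _ ≤ _ := by
        rw [Finset.mul_sum, ← Fin.sum_univ_eq_sum_range]
        refine Finset.sum_le_sum fun j _ => ?_
        have hjN : ((j : ℕ) : ℝ) + 1 ≤ N := by exact_mod_cast j.2
        have hθw : θ j < a + width k := by
          have := mul_le_mul_of_nonneg_right hjN hδ0.le
          linarith [hθr j]
        refine (stoppedCharge_le_cumulative (by norm_num) ha hδ0.le hw0.le hw1 (hθ j)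
          (by linarith) j (hθl j) hθw (b j) σ n []).trans ?_
        refine cumulative_mono (oddsPrior_nonneg (hθ j)) (fun h => charge_nonneg (by norm_num)
          (le_add_of_nonneg_right (by positivity)) _) (by omega) _

/-- Paths that select a subinterval at each of the first `K` levels. -/
abbrev Digits (K : ℕ) : Type := ∀ k : Fin K, Fin (branching k)

/-- The left end of the interval at level `k` of a path. -/
noncomputable def leftEnd {K : ℕ} (d : Digits K) (k : ℕ) : ℝ :=
  1 / 2 + ∑ i ∈ Finset.range k, (if h : i < K then ((d ⟨i, h⟩ : ℕ) : ℝ) else 0) * width (i + 1)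

section Digits

variable {K : ℕ} (d : Digits K)

lemma leftEnd_zero : leftEnd d 0 = 1 / 2 := by simp [leftEnd]

lemma leftEnd_succ (k : ℕ) : leftEnd d (k + 1) =
    leftEnd d k + (if h : k < K then ((d ⟨k, h⟩ : ℕ) : ℝ) else 0) * width (k + 1) := by
  rw [leftEnd, Finset.sum_range_succ, leftEnd, add_assoc]

lemma leftEnd_succ_fin (k : Fin K) :
    leftEnd d (k + 1) = leftEnd d k + (d k : ℕ) * width (k + 1) := by
  rw [leftEnd_succ, dif_pos k.2]

/-- The interval at level `k` depends only on earlier digits, so resampling digit `k` moves the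
target among the parts of a fixed interval. -/
lemma leftEnd_update (k : Fin K) (j : Fin (branching k)) :
    leftEnd (Function.update d k j) k = leftEnd d k := by
  unfold leftEnd
  congr 1
  refine Finset.sum_congr rfl fun i hi => ?_
  have hi := Finset.mem_range.1 hi
  rw [dif_pos (hi.trans k.2), dif_pos (hi.trans k.2), Function.update_of_ne]
  exact fun e => hi.ne (congrArg Fin.val e)

lemma leftEnd_monotone : Monotone (leftEnd d) := by
  refine monotone_nat_of_le_succ fun k => ?_
  rw [leftEnd_succ]
  have := (width_pos (k + 1)).le
  refine le_add_of_nonneg_right (mul_nonneg ?_ this)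
  split_ifs <;> positivity

lemma leftEnd_add_width_antitone : Antitone fun k => leftEnd d k + width k := by
  refine antitone_nat_of_succ_le fun k => ?_
  have hw := width_pos (k + 1)
  have hb := branching_mul_width_succ k
  rw [leftEnd_succ]
  have : (if h : k < K then ((d ⟨k, h⟩ : ℕ) : ℝ) else 0) + 1 ≤ branching k := by
    split_ifs with h
    · exact_mod_cast (d ⟨k, h⟩).2
    · rw [zero_add]; exact_mod_cast branching_pos k
  have := mul_le_mul_of_nonneg_right this hw.le
  linarith

lemma leftEnd_lt (k : ℕ) (hk : k ≤ K) : leftEnd d K < leftEnd d k + width k := by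
  have := leftEnd_add_width_antitone d hk
  dsimp only at this
  linarith [width_pos K]

lemma width_zero : width 0 = 1 / 8 := by norm_num [width, branching]

lemma half_le_leftEnd (k : ℕ) : 1 / 2 ≤ leftEnd d k :=
  (leftEnd_zero d).symm.le.trans (leftEnd_monotone d k.zero_le)

lemma leftEnd_nonneg (k : ℕ) : 0 ≤ leftEnd d k := le_trans (by norm_num) (half_le_leftEnd d k)

lemma leftEnd_add_width_le (k : ℕ) : leftEnd d k + width k ≤ 5 / 8 := by
  have := leftEnd_add_width_antitone d k.zero_le
  dsimp only at this
  rw [leftEnd_zero, width_zero] at this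
  linarith

lemma leftEnd_lt_one (k : ℕ) : leftEnd d k < 1 := by
  linarith [leftEnd_add_width_le d k, width_pos k]

end Digits

/-! ### Averaging over paths, and the depth -/

/-- Resampling one coordinate does not change the mean over a finite product. -/
lemma sum_sum_update {ι : Type*} [DecidableEq ι] [Fintype ι] {β : ι → Type*}
    [∀ i, Fintype (β i)] (k : ι) (f : (∀ i, β i) → ℝ) :
    ∑ d, ∑ j, f (Function.update d k j) = Fintype.card (β k) * ∑ d, f d := by
  have hinv : Function.Involutive fun q : (∀ i, β i) × β k => (Function.update q.1 k q.2, q.1 k) := by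
    rintro ⟨d, j⟩
    simp
  rw [← Fintype.sum_prod_type' (f := fun d j => f (Function.update d k j)),
    Fintype.sum_equiv hinv.toPerm (fun q => f (Function.update q.1 k q.2)) (fun q => f q.1)
      (fun q => rfl), Fintype.sum_prod_type]
  simp [Finset.mul_sum]

/-- Against a uniformly random path, any policy has a total loss proportional to the depth. -/
lemma sum_sub_totalUtility_ge {K T : ℕ} (hT : ∀ k < K, branching k ≤ 4 * T)
    (b : ∀ d : Digits K, ReceiverBehavior (matchingInstance (leftEnd d K) (leftEnd_nonneg d K))
      (Fin 2))
    (σ : PersuasionHistory (Fin 2) (Fin 2) (Fin 2) → SignalingScheme (Fin 2) (Fin 2)) :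
    (Fintype.card (Digits K) : ℝ) * (K * (7 / 2048)) ≤ ∑ d : Digits K,
      (T * (2 * (leftEnd d K / (1 + leftEnd d K))) -
        (matchingInstance (leftEnd d K) (leftEnd_nonneg d K)).totalUtility (b d) σ T []) := by
  let V : ℕ → Digits K → ℝ := fun k d =>
    cumulative (oddsPrior (leftEnd d K)) (fun h s => (b d).act h (σ h) s) σ
      (fun h => charge (1 / 32) (leftEnd d k) (width k) (leftEnd d (k + 1)) (width (k + 1))
        (threshold (σ h))) T []
  have hV : ∀ d, 1 / 2 * ∑ k ∈ Finset.range K, V k d ≤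
      T * (2 * (leftEnd d K / (1 + leftEnd d K))) -
        (matchingInstance (leftEnd d K) (leftEnd_nonneg d K)).totalUtility (b d) σ T [] := by
    intro d
    have h1 := half_le_leftEnd d K
    have hc : ∀ h, 1 / 2 * ∑ k ∈ Finset.range K, charge (1 / 32) (leftEnd d k) (width k)
        (leftEnd d (k + 1)) (width (k + 1)) (threshold (σ h)) ≤
        if leftEnd d K < threshold (σ h) then 2 * (leftEnd d K / (1 + leftEnd d K))
        else (leftEnd d K - threshold (σ h)) / 2 := by
      intro h
      have := sum_charge_le (F := 1 / 32) (by norm_num) (leftEnd_monotone d)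
        (leftEnd_add_width_antitone d) width_pos K (threshold (σ h))
      split_ifs at this ⊢ with hx
      -- Targets are at least `1 / 2`, so overshooting loses at least `2 / 3`, more than half of the
      -- total charge.
      · have h2 : (1 : ℝ) / 3 ≤ leftEnd d K / (1 + leftEnd d K) := by
          rw [div_le_div_iff₀ (by norm_num) (by linarith)]
          linarith
        linarith [leftEnd_lt_one d K, leftEnd_zero d]
      · linarith
    have := totalUtility_add_cumulative_le (leftEnd_nonneg d K) (leftEnd_lt_one d K) (b d) σ hc T []
    rw [cumulative_const_mul, cumulative_sum] at this
    linarith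
  have hlevel : ∀ k ∈ Finset.range K,
      (Fintype.card (Digits K) : ℝ) * (7 / 1024) ≤ ∑ d, V k d := by
    intro k hk
    have hk := Finset.mem_range.1 hk
    have hpos : (0 : ℝ) < branching k := by exact_mod_cast branching_pos k
    have hmean := sum_sum_update (⟨k, hk⟩ : Fin K) (V k)
    rw [Fintype.card_fin] at hmean
    refine le_of_mul_le_mul_left ?_ hpos
    rw [← hmean]
    calc (branching k : ℝ) * (Fintype.card (Digits K) * (7 / 1024))
        = ∑ _d : Digits K, (branching k : ℝ) * (7 / 1024) := by
          rw [Finset.sum_const, Finset.card_univ, nsmul_eq_mul]; ring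
      _ ≤ _ := by
          refine Finset.sum_le_sum fun d _ => ?_
          have hsucc : ∀ j : Fin (branching k), leftEnd (Function.update d ⟨k, hk⟩ j) (k + 1) =
              leftEnd d k + (j : ℕ) * width (k + 1) := by
            intro j
            have := leftEnd_succ_fin (Function.update d ⟨k, hk⟩ j) ⟨k, hk⟩
            rwa [leftEnd_update, Function.update_self] at this
          have hself : ∀ j : Fin (branching k), leftEnd (Function.update d ⟨k, hk⟩ j) k =
              leftEnd d k := fun j => leftEnd_update d ⟨k, hk⟩ j
          -- The tie-breaking rule may change with `j`, and the later digits place the target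
          -- anywhere in the `j`-th part.
          have := sum_cumulative_charge_ge k (leftEnd_nonneg d k)
            (by linarith [leftEnd_add_width_le d k])
            (fun j => leftEnd (Function.update d ⟨k, hk⟩ j) K) (fun j => leftEnd_nonneg _ K)
            (fun j => (hsucc j).symm.le.trans (leftEnd_monotone _ hk))
            (fun j => by
              have := leftEnd_lt (Function.update d ⟨k, hk⟩ j) (k + 1) hk
              rw [hsucc] at this
              linarith)
            (fun j => b (Function.update d ⟨k, hk⟩ j)) σ (hT k hk)
          simpa only [V, hsucc, hself] using this
  calc (Fintype.card (Digits K) : ℝ) * (K * (7 / 2048))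
      = 1 / 2 * ∑ _k ∈ Finset.range K, (Fintype.card (Digits K) : ℝ) * (7 / 1024) := by
        rw [Finset.sum_const, Finset.card_range, nsmul_eq_mul]; ring
    _ ≤ 1 / 2 * ∑ k ∈ Finset.range K, ∑ d, V k d :=
        mul_le_mul_of_nonneg_left (Finset.sum_le_sum hlevel) (by norm_num)
    _ = ∑ d, 1 / 2 * ∑ k ∈ Finset.range K, V k d := by rw [Finset.sum_comm, Finset.mul_sum]
    _ ≤ _ := Finset.sum_le_sum fun d _ => hV d

/-- The number of levels that can be explored in `T` periods is of order `log log T`. -/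
lemma exists_depth {T : ℕ} (hT : 3 ≤ T) : ∃ K : ℕ, 1 ≤ K ∧ (∀ k < K, branching k ≤ 4 * T) ∧
    Real.log (Real.log T) ≤ 2 * K := by
  -- `branching k = 2 ^ 2 ^ (k + 1)` is at most `T` when `k + 1 ≤ log₂ log₂ T`. The maximum keeps
  -- one level for small `T`, where `branching 0 = 4` is enough.
  refine ⟨max 1 (Nat.log 2 (Nat.log 2 T)), le_max_left _ _, fun k hk => ?_, ?_⟩
  · rcases Nat.eq_zero_or_pos k with rfl | hk0
    · simp [branching]; omega
    · have hk' : k + 1 ≤ Nat.log 2 (Nat.log 2 T) := by omega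
      have hl : Nat.log 2 T ≠ 0 := by
        intro h
        rw [h] at hk'
        simp at hk'
      have h1 : 2 ^ (k + 1) ≤ Nat.log 2 T :=
        (Nat.pow_le_pow_right (by norm_num) hk').trans (Nat.pow_log_le_self 2 hl)
      have h2 : 2 ^ 2 ^ (k + 1) ≤ T :=
        (Nat.pow_le_pow_right (by norm_num) h1).trans (Nat.pow_log_le_self 2 (by omega))
      have h3 : branching k = 2 ^ 2 ^ (k + 1) := by
        rw [branching, show 4 = 2 ^ 2 by rfl, ← pow_mul, pow_succ 2 k, mul_comm]
      omega
  · set l := Nat.log 2 T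
    set L := Nat.log 2 l
    have log_two : Real.log 2 ≤ 1 := Real.log_two_lt_d9.le.trans (by norm_num)
    have log_le : ∀ (x : ℝ) (m : ℕ), 0 < x → x ≤ 2 ^ m → Real.log x ≤ m := by
      intro x m hx hm
      calc Real.log x ≤ Real.log (2 ^ m) := Real.log_le_log hx hm
        _ = m * Real.log 2 := by rw [Real.log_pow]
        _ ≤ m := mul_le_of_le_one_right m.cast_nonneg log_two
    have hT3 : (3 : ℝ) ≤ T := by exact_mod_cast hT
    have hlT : Real.log T ≤ ((l + 1 : ℕ) : ℝ) := log_le T (l + 1) (by linarith)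
      (by exact_mod_cast (Nat.lt_pow_succ_log_self (by norm_num) T).le)
    have hlL : l + 1 ≤ 2 ^ (L + 1) := Nat.lt_pow_succ_log_self (by norm_num) l
    have hlL' : ((l + 1 : ℕ) : ℝ) ≤ 2 ^ (L + 1) := by exact_mod_cast hlL
    have := log_le (Real.log T) (L + 1) (Real.log_pos (by linarith)) (hlT.trans hlL')
    have hK : L + 1 ≤ 2 * max 1 L := by omega
    have hK' : ((L + 1 : ℕ) : ℝ) ≤ 2 * (max 1 L : ℕ) := by exact_mod_cast hK
    linarith

/-! ### Integrability in the seed -/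

lemma totalUtility_mem_Icc {Ω A S : Type} [Fintype Ω] [Fintype S] (I : PersuasionInstance Ω A)
    (b : ReceiverBehavior I S) (σ : PersuasionHistory Ω S A → SignalingScheme Ω S) (n : ℕ)
    (h : PersuasionHistory Ω S A) : I.totalUtility b σ n h ∈ Set.Icc (0 : ℝ) n := by
  induction n generalizing h with
  | zero => simp [PersuasionInstance.totalUtility]
  | succ n ih =>
    have hsum : ∀ ω, ∑ s, (σ h ω).1 s = 1 := fun ω => (σ h ω).2.2
    rw [PersuasionInstance.totalUtility]
    constructor
    · exact Finset.sum_nonneg fun ω _ => mul_nonneg (I.prior_mem.1 ω) <| Finset.sum_nonneg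
        fun s _ => mul_nonneg ((σ h ω).2.1 s) (add_nonneg (I.u_mem _ _).1 (ih _).1)
    · calc _ ≤ ∑ ω, I.prior ω * ∑ s, (σ h ω).1 s * (1 + n) := by
            gcongr with ω _ s _
            · exact I.prior_mem.1 ω
            · exact (σ h ω).2.1 s
            · exact (I.u_mem _ _).2
            · exact (ih _).2
        _ = ((n + 1 : ℕ) : ℝ) := by
            simp only [← Finset.sum_mul, hsum, one_mul, I.prior_mem.2]
            push_cast
            ring

/-- The next history depends on the seed through the action; splitting by the finitely many actions
leaves fixed histories, to which the induction applies. -/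
lemma measurable_totalUtility {Ω A S : Type} [Fintype Ω] [Fintype S] [Fintype A]
    (I : PersuasionInstance Ω A) (b : ReceiverBehavior I S) {R : Type*} [MeasurableSpace R]
    {σ : R → PersuasionHistory Ω S A → SignalingScheme Ω S}
    (hσ : ∀ h, Measurable fun r => σ r h) (n : ℕ) (h : PersuasionHistory Ω S A) :
    Measurable fun r => I.totalUtility b (σ r) n h := by
  classical
  induction n generalizing h with
  | zero => exact measurable_const
  | succ n ih =>
    simp only [PersuasionInstance.totalUtility]
    refine Finset.measurable_fun_sum _ fun ω _ => Measurable.const_mul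
      (Finset.measurable_fun_sum _ fun s _ => Measurable.mul ?_ ?_) _
    · exact (measurable_pi_apply s).comp
        (measurable_subtype_coe.comp ((measurable_pi_apply ω).comp (hσ h)))
    · have e : (fun r => I.u (b.act h (σ r h) s) ω +
          I.totalUtility b (σ r) n ((ω, s, b.act h (σ r h) s) :: h)) = fun r =>
          ∑ a, if b.act h (σ r h) s = a then I.u a ω + I.totalUtility b (σ r) n ((ω, s, a) :: h)
            else 0 := by
        funext r
        rw [Finset.sum_ite_eq, if_pos (Finset.mem_univ _)]
      rw [e]
      exact Finset.measurable_fun_sum _ fun a _ => Measurable.ite (hσ h (b.measurable_act h s a))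
        ((ih _).const_add _) measurable_const

lemma integrable_totalUtility {Ω A S : Type} [Fintype Ω] [Fintype S] [Fintype A]
    (I : PersuasionInstance Ω A) (b : ReceiverBehavior I S) {R : Type*} [MeasurableSpace R]
    {μ : Measure R} [IsFiniteMeasure μ]
    {σ : R → PersuasionHistory Ω S A → SignalingScheme Ω S}
    (hσ : ∀ h, Measurable fun r => σ r h) (n : ℕ) (h : PersuasionHistory Ω S A) :
    Integrable (fun r => I.totalUtility b (σ r) n h) μ := by
  refine Integrable.of_bound (measurable_totalUtility I b hσ n h).aestronglyMeasurable n
    (Filter.Eventually.of_forall fun r => ?_)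
  have := totalUtility_mem_Icc I b (σ r) n h
  rw [Real.norm_eq_abs, abs_of_nonneg this.1]
  exact this.2

end ThresholdPersuasion

/-! ### Averaging over the seed and conclusion -/

theorem theorem4 :
    ∃ c : ℝ, 0 < c ∧
      ∀ (alg : PersuasionAlgorithm.{u} (Fin 2) (Fin 2) (Fin 2)) (T : ℕ), 3 ≤ T →
        ∃ I : PersuasionInstance (Fin 2) (Fin 2),
          I.IsBinaryActionCase ∧ (∀ ω, 0 < I.prior ω) ∧
            ∀ b : ReceiverBehavior I (Fin 2),
              c * Real.log (Real.log T) ≤ I.regret b (alg T I.u I.v) T := by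
  open ThresholdPersuasion in
  refine ⟨1 / 1000, by norm_num, fun alg T hT => ?_⟩
  -- Otherwise every leaf has a tie-breaking rule with small regret. All leaves share `u` and `v`,
  -- so they all face the same policy.
  by_contra! hcon
  obtain ⟨K, hK1, hKT, hKlog⟩ := exists_depth hT
  choose b hb using fun d : Digits K =>
    hcon (matchingInstance (leftEnd d K) (leftEnd_nonneg d K))
      (matchingInstance_isBinaryActionCase _ (leftEnd_lt_one d K))
      (oddsPrior_pos (by linarith [half_le_leftEnd d K]))
  set P := alg T designerUtility receiverUtility
  let _ := P.seedSpace
  have := P.seedProb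
  let W : Digits K → P.Seed → ℝ := fun d r =>
    (matchingInstance (leftEnd d K) (leftEnd_nonneg d K)).totalUtility (b d) (P.scheme r) T []
  have hU : ∀ d : Digits K, T * (2 * (leftEnd d K / (1 + leftEnd d K))) ≤
      T * (matchingInstance (leftEnd d K) (leftEnd_nonneg d K)).optimalUtility := fun d =>
    mul_le_mul_of_nonneg_left (le_optimalUtility _ (leftEnd_lt_one d K).le) T.cast_nonneg
  have hreg : ∀ d, T * (2 * (leftEnd d K / (1 + leftEnd d K))) - ∫ r, W d r ∂P.seedLaw <
      1 / 1000 * Real.log (Real.log T) := fun d =>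
    (sub_le_sub_right (hU d) _).trans_lt (hb d)
  have hint : ∀ d, Integrable (W d) P.seedLaw := fun d =>
    integrable_totalUtility _ (b d) P.measurable_scheme T []
  have hmean : (Fintype.card (Digits K) : ℝ) * (K * (7 / 2048)) ≤
      ∑ d, (T * (2 * (leftEnd d K / (1 + leftEnd d K))) - ∫ r, W d r ∂P.seedLaw) := by
    calc (Fintype.card (Digits K) : ℝ) * (K * (7 / 2048))
        = ∫ _r, (Fintype.card (Digits K) : ℝ) * (K * (7 / 2048)) ∂P.seedLaw := by simp
      _ ≤ ∫ r, ∑ d, (T * (2 * (leftEnd d K / (1 + leftEnd d K))) - W d r) ∂P.seedLaw :=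
          integral_mono (integrable_const _)
            (integrable_finsetSum _ fun d _ => (integrable_const _).sub (hint d))
            fun r => sum_sub_totalUtility_ge hKT b (P.scheme r)
      _ = _ := by
          refine (integral_finsetSum _ fun d _ => (integrable_const _).sub (hint d)).trans ?_
          refine Finset.sum_congr rfl fun d _ => ?_
          rw [integral_sub' (integrable_const _) (hint d)]
          simp
  have hlt : ∑ d : Digits K, (T * (2 * (leftEnd d K / (1 + leftEnd d K))) -
      ∫ r, W d r ∂P.seedLaw) ≤ Fintype.card (Digits K) * (1 / 1000 * (2 * K)) := by
    rw [← nsmul_eq_mul, ← Finset.card_univ]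
    exact Finset.sum_le_card_nsmul _ _ _ fun d _ => (hreg d).le.trans (by linarith)
  have : ∀ k, NeZero (branching k) := fun k => ⟨(branching_pos k).ne'⟩
  have hcard : (0 : ℝ) < Fintype.card (Digits K) := by exact_mod_cast Fintype.card_pos
  -- Dividing by the number of leaves leaves `7 K / 2048 ≤ 2 K / 1000`, which is false for `K ≥ 1`.
  have := le_of_mul_le_mul_left (hmean.trans hlt) hcard
  have hK1' : (1 : ℝ) ≤ K := by exact_mod_cast hK1
  linarith
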